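/- Let $D$ be a probability distribution on prompts, let $\pi(\cdot\mid x)$ be a policy (a Markov kernel from prompts to responses), and let $r(x,y)\in\{0,1\}$ be a measurable binary reward. For a prompt $x$ put $p(x)=\mathbb{E}_{y\sim\pi(\cdot\mid x)}[r(x,y)]$ (the expected reward), and assume that for $x\sim D$ the random variable $p(x)$ is uniformly distributed on $[0,1]$. Let $G\ge 6$ be an integer. Given $x$, draw $y_1,\dots,y_G$ independently from $\pi(\cdot\mid x)$ and write $r_i=r(x,y_i)$, $R=\sum_{j=1}^G r_j$, $\hat p=R/G$, $\mathcal S=\{1\le R\le G-1\}$. For $i\in\{1,\dots,G\}$ let $\hat A_i=r_i-\hat p$ be the group-relative advantage and $A_i=r_i-p(x)$ the true (expected) advantage. For an event $E$ about the group and a set $B\subseteq\mathbb{R}$ of values of $p$, write $$\mathbb{P}(E\mid\mathcal S,\ p\in B)=\frac{1}{D(\{x: p(x)\in B\})}\int_{\{x:\,p(x)\in B\}}\mathbb{P}_{y_1,\dots,y_G\sim\pi(\cdot\mid x)}(E\mid\mathcal S)\,dD(x),$$ that is, the conditional probability given $\mathcal S$ at a fixed prompt, averaged over the prompts with $p(x)\in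 B$ (equivalently, averaged over $p$ uniform on $B\cap[0,1]$). Then, for every $i\in\{1,\dots,G\}$, $$\mathbb{P}\Bigl(\hat A_i<A_i\ \Big|\ \mathcal S,\ p<\tfrac{2}{G}\Bigr)>0.78,\qquad \mathbb{P}\Bigl(\hat A_i>A_i\ \Big|\ \mathcal S,\ p>\tfrac{G-2}{G}\Bigr)>0.78 .$$ -/

import Mathlib

open MeasureTheory ProbabilityTheory

namespace GroupRL

/-- The expected reward `p x = 𝔼_{y ∼ π(· ∣ x)} [r x y]` of the policy `π` on the prompt `x`. -/
noncomputable def expectedReward {X Y : Type*} [MeasurableSpace X] [MeasurableSpace Y]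
    (π : Kernel X Y) (r : X → Y → ℝ) (x : X) : ℝ :=
  ∫ y, r x y ∂(π x)

/-- The law of a group of `G` responses sampled independently from `π(· ∣ x)`. -/
noncomputable def groupLaw {X Y : Type*} [MeasurableSpace X] [MeasurableSpace Y]
    (π : Kernel X Y) (G : ℕ) (x : X) : Measure (Fin G → Y) :=
  Measure.pi fun _ => π x

/-- The total reward `R` of a group `y` of responses to the prompt `x`. -/
noncomputable def totalReward {X Y : Type*} (r : X → Y → ℝ) {G : ℕ} (x : X) (y : Fin G → Y) : ℝ :=
  ∑ j, r x (y j)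

/-- The group baseline `R / G`. -/
noncomputable def groupBaseline {X Y : Type*} (r : X → Y → ℝ) {G : ℕ} (x : X) (y : Fin G → Y) : ℝ :=
  totalReward r x y / G

/-- The group-relative advantage of the `i`-th response. -/
noncomputable def groupAdvantage {X Y : Type*} (r : X → Y → ℝ) {G : ℕ} (i : Fin G)
    (x : X) (y : Fin G → Y) : ℝ :=
  r x (y i) - groupBaseline r x y

/-- The true (expected) advantage of the `i`-th response. -/
noncomputable def trueAdvantage {X Y : Type*} [MeasurableSpace X] [MeasurableSpace Y]
    (π : Kernel X Y) (r : X → Y → ℝ) {G : ℕ} (i : Fin G) (x : X) (y : Fin G → Y) : ℝ :=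
  r x (y i) - expectedReward π r x

/-- The non-degenerate event `𝒮 = {1 ≤ R ≤ G - 1}` for the prompt `x`. -/
def nonDegenerate {X Y : Type*} (r : X → Y → ℝ) (G : ℕ) (x : X) : Set (Fin G → Y) :=
  {y | 1 ≤ totalReward r x y ∧ totalReward r x y ≤ (G : ℝ) - 1}

/-- The probability of the event `E` for a group of responses to the given prompt `x`,
conditioned on the group being non-degenerate: `ℙ(E ∣ 𝒮)` at the prompt `x`. -/
noncomputable def probGivenS {X Y : Type*} [MeasurableSpace X] [MeasurableSpace Y]
    (π : Kernel X Y) (r : X → Y → ℝ) (G : ℕ) (E : X → (Fin G → Y) → Prop) (x : X) : ℝ :=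
  ((groupLaw π G x)[|nonDegenerate r G x]).real {y | E x y}

/-- `ℙ(E ∣ 𝒮, p ∈ B)` for a random prompt `x ∼ D`: the mean of `ℙ(E ∣ 𝒮)` over the prompts whose
expected reward lies in `B`. If `p` is uniform on `[0,1]` and `B` is an interval with endpoints
`a < b` in `[0,1]`, this is `(b - a)⁻¹ * ∫ f p dp` over `[a, b]`, with `f p` the probability of `E`
given `𝒮` at expected reward `p`. -/
noncomputable def meanProbGivenS {X Y : Type*} [MeasurableSpace X] [MeasurableSpace Y]
    (D : Measure X) (π : Kernel X Y) (r : X → Y → ℝ) (G : ℕ) (E : X → (Fin G → Y) → Prop)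
    (B : Set ℝ) : ℝ :=
  ⨍ x in {x | expectedReward π r x ∈ B}, probGivenS π r G E x ∂D

end GroupRL

/-!
At a prompt of expected reward `p`, with `q = 1 - p` and `n = G`, the total reward `R` is binomial
with parameters `n` and `p` (`groupLaw_real_card_rewarded_eq`), and the group-relative advantage
underestimates the true one exactly when `R > n p`. Given `1 ≤ R ≤ n - 1` and `0 < p < 2 / n`, this
is certain if `p < 1 / n`, and otherwise fails exactly when `R = 1`
(`probGivenS_groupAdvantage_lt`). With `n p = 1 + s`, the first claim thus says that the mean over
`s ∈ [0, 1]` of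
`h = n p q ^ (n - 1) / (1 - q ^ n - p ^ n)`
is below `0.44`. As `n → ∞` that mean tends to the mean of `t / (e ^ t - 1)` over `t ∈ [1, 2]`,
about `0.437`, and it is slightly larger for `n = 6`, so little may be lost.

The function `h` is bounded by `ratioBound n s`, a quadratic polynomial in `s` whose coefficients
are quadratic in `1 / n` and which nearly interpolates `h` for `n = 6`, `n = 12` and `n = ∞`; its
mean over `s ∈ [0, 1]` is below `0.44` for all `n ≥ 6` (`integral_ratioBound_lt`). For the pointwise
bound the denominator is replaced by the first terms of the binomial expansion
(`binomial_terms_le`), which leaves a polynomial inequality in `n - 6 ≥ 0` and `s ∈ [0, 1]`. Written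
homogeneously in `s` and `1 - s`, all its coefficients are positive (`bernstein_form_nonneg`).

The second claim is the first one for the reward `1 - r` (`meanProbGivenS_one_sub`).
-/

namespace GroupRL

/-! ### The bound for the probability of a single success -/

/-- The upper bound for `n p q ^ (n - 1) / (1 - q ^ n - p ^ n)` at `p = (1 + s) / n`, `q = 1 - p`,
for `n ≥ 6` and `0 ≤ s ≤ 1`. Its coefficients in `s` are, up to rounding and a safety margin of about
`0.001`, those of the quadratic interpolation of that function in `s` and `1 / n`. -/
noncomputable def ratioBound (n s : ℝ) : ℝ :=
  ((146 * n ^ 2 + 31 * n + 18) - (84 * n ^ 2 + 45 * n + 45) * s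
    + (17 * n ^ 2 - 9 * n - 73) * s ^ 2) / (250 * n ^ 2)

/-- The polynomial inequality behind `one_success_le_ratioBound_mul`, for `n = v + 6`, homogenized in
`s` and `u = 1 - s`: then `1 + s` becomes `2 * s + u`, and `n - 1 - s` becomes
`v * (s + u) + 4 * s + 5 * u`. In this form, which amounts to the Bernstein form in `s`, the expanded
polynomial has only positive coefficients. -/
theorem bernstein_form_nonneg {v s u : ℝ} (hv : 0 ≤ v) (hs : 0 ≤ s) (hu : 0 ≤ u) :
    0 ≤ ((146 * (v + 6) ^ 2 + 31 * (v + 6) + 18) * (s + u) ^ 2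
        - (84 * (v + 6) ^ 2 + 45 * (v + 6) + 45) * s * (s + u)
        + (17 * (v + 6) ^ 2 - 9 * (v + 6) - 73) * s ^ 2)
      * ((v * (s + u) + 4 * s + 5 * u) ^ 5
        + (v + 5) / 2 * (2 * s + u) * (v * (s + u) + 4 * s + 5 * u) ^ 4
        + (v + 5) * (v + 4) / 6 * (2 * s + u) ^ 2 * (v * (s + u) + 4 * s + 5 * u) ^ 3
        + (v + 5) * (v + 4) * (v + 3) / 24 * (2 * s + u) ^ 3 * (v * (s + u) + 4 * s + 5 * u) ^ 2
        + (v + 5) * (v + 4) * (v + 3) * (v + 2) / 120 * (2 * s + u) ^ 4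
          * (v * (s + u) + 4 * s + 5 * u)
        + (v + 4) * (v + 3) * (v + 2) * (v + 1) * v / 720 * (2 * s + u) ^ 5)
      - 250 * (v + 6) ^ 2 * (s + u) ^ 2 * (v * (s + u) + 4 * s + 5 * u) ^ 5 := by
  ring_nf
  positivity

/-- The probability that some but not all of `n` trials succeed is at least that of having between
`1` and `6` successes, with the coefficient `n.choose 6` lowered so that the last term vanishes for
`n = 6`, where it must not be counted. -/
theorem binomial_terms_le {n : ℕ} (hn : 6 ≤ n) {p : ℝ} (hp0 : 0 ≤ p) (hp1 : p ≤ 1) :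
    (n * p * (1 - p) ^ 5 + n * (n - 1) / 2 * p ^ 2 * (1 - p) ^ 4
        + n * (n - 1) * (n - 2) / 6 * p ^ 3 * (1 - p) ^ 3
        + n * (n - 1) * (n - 2) * (n - 3) / 24 * p ^ 4 * (1 - p) ^ 2
        + n * (n - 1) * (n - 2) * (n - 3) * (n - 4) / 120 * p ^ 5 * (1 - p)
        + n * (n - 2) * (n - 3) * (n - 4) * (n - 5) * (n - 6) / 720 * p ^ 6) * (1 - p) ^ (n - 6)
      ≤ 1 - (1 - p) ^ n - p ^ n := by
  have hq : 0 ≤ 1 - p := by linarith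
  have hsum := add_pow p (1 - p) n
  rw [add_sub_cancel, one_pow] at hsum
  obtain rfl | hn7 := hn.eq_or_lt
  · simp [Finset.sum_range_succ, Nat.choose] at hsum
    norm_num
    linarith
  obtain ⟨m, rfl⟩ := Nat.exists_eq_add_of_le' hn7
  have hc (k : ℕ) : ((m + 7).descFactorial k : ℝ) = k.factorial * ((m + 7).choose k : ℝ) := by
    exact_mod_cast Nat.descFactorial_eq_factorial_mul_choose _ _
  have h2 := hc 2
  have h3 := hc 3
  have h4 := hc 4
  have h5 := hc 5
  have h6 := hc 6
  simp [Nat.descFactorial, Nat.factorial] at h2 h3 h4 h5 h6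
  rw [Finset.sum_range_succ] at hsum
  have hle : ∑ k ∈ Finset.range 7, p ^ k * (1 - p) ^ (m + 7 - k) * ((m + 7).choose k : ℝ) ≤
      ∑ k ∈ Finset.range (m + 7), p ^ k * (1 - p) ^ (m + 7 - k) * ((m + 7).choose k : ℝ) :=
    Finset.sum_le_sum_of_subset_of_nonneg (by simp) fun _ _ _ => by positivity
  have hle' : ∑ k ∈ Finset.range 7, p ^ k * (1 - p) ^ (m + 7 - k) * ((m + 7).choose k : ℝ)
      ≤ 1 - p ^ (m + 7) := by
    refine hle.trans (le_of_eq ?_)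
    simp at hsum
    linarith
  simp [Finset.sum_range_succ] at hle'
  rw [show ((m + 7).choose 2 : ℝ) = (m + 6) * (m + 7) / 2 by linarith,
    show ((m + 7).choose 3 : ℝ) = (m + 5) * ((m + 6) * (m + 7)) / 6 by linarith,
    show ((m + 7).choose 4 : ℝ) = (m + 4) * ((m + 5) * ((m + 6) * (m + 7))) / 24 by linarith,
    show ((m + 7).choose 5 : ℝ) = (m + 3) * ((m + 4) * ((m + 5) * ((m + 6) * (m + 7)))) / 120 by
      linarith,
    show ((m + 7).choose 6 : ℝ) =
      (m + 2) * ((m + 3) * ((m + 4) * ((m + 5) * ((m + 6) * (m + 7))))) / 720 by linarith] at hle'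
  -- The gain from replacing `(n - 1) ⋯ (n - 5)` by `(n - 2) ⋯ (n - 6)` in the last coefficient.
  have hgap : 0 ≤ (m + 2) * ((m + 3) * ((m + 4) * ((m + 5) * (m + 7)))) / 144 * p ^ 6
      * (1 - p) ^ (m + 1) := by positivity
  have hexp : m + Nat.succ 6 - 6 = m + 1 := by omega
  rw [hexp]
  push_cast
  ring_nf at hle' hgap ⊢
  linarith

/-- In the range `1 / n ≤ p ≤ 2 / n`, written `p = (1 + s) / n`, the probability that exactly one
of `n` trials succeeds is at most `ratioBound n s` times the probability that some but not all of
them succeed. -/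
theorem one_success_le_ratioBound_mul {n : ℕ} (hn : 6 ≤ n) {p : ℝ} (hp1 : 1 / n ≤ p)
    (hp2 : p ≤ 2 / n) :
    n * p * (1 - p) ^ (n - 1) ≤ ratioBound n (n * p - 1) * (1 - (1 - p) ^ n - p ^ n) := by
  have hn6 : (6 : ℝ) ≤ n := by exact_mod_cast hn
  have hn0 : (0 : ℝ) < n := by linarith
  have hs0 : 0 ≤ n * p - 1 := by
    rw [div_le_iff₀ hn0] at hp1; linarith
  have hs1 : n * p - 1 ≤ 1 := by
    rw [le_div_iff₀ hn0] at hp2; linarith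
  obtain ⟨s, hs⟩ : ∃ s : ℝ, n * p - 1 = s := ⟨_, rfl⟩
  rw [hs] at hs0 hs1 ⊢
  have hps : p = (1 + s) / n := by
    rw [eq_div_iff hn0.ne']; linarith
  have hp0 : 0 ≤ p := by rw [hps]; positivity
  have hple : p ≤ 1 := by
    rw [hps, div_le_one hn0]; linarith
  have hA : 0 ≤ ratioBound n s := by
    unfold ratioBound
    apply div_nonneg _ (by positivity)
    nlinarith [mul_nonneg hs0 (sub_nonneg.2 hs1), mul_nonneg hs0 hn0.le, sq_nonneg s]
  refine le_trans ?_ (mul_le_mul_of_nonneg_left (binomial_terms_le hn hp0 hple) hA)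
  have hsplit : (1 - p) ^ (n - 1) = (1 - p) ^ 5 * (1 - p) ^ (n - 6) := by
    rw [← pow_add]; congr 1; omega
  rw [hsplit, ← mul_assoc, ← mul_assoc]
  refine mul_le_mul_of_nonneg_right ?_ (pow_nonneg (by linarith) _)
  -- After division by `p * (1 - p) ^ (n - 6)` and clearing of denominators, this is
  -- `bernstein_form_nonneg`.
  have h := bernstein_form_nonneg (v := n - 6) (s := s) (u := 1 - s) (by linarith) hs0
    (by linarith)
  have hfac : 0 < (1 + s) / (250 * (n : ℝ) ^ 7) := by positivity
  have h' := mul_nonneg hfac.le h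
  rw [← sub_nonneg]
  refine h'.trans (le_of_eq ?_)
  rw [hps]
  unfold ratioBound
  field_simp
  ring

theorem integral_ratioBound_lt {n : ℝ} (hn : 6 ≤ n) :
    ∫ s in (0 : ℝ)..1, ratioBound n s < 0.44 := by
  have hn0 : 0 < n := by linarith
  have hI : ∫ s in (0 : ℝ)..1, ratioBound n s = ((146 * n ^ 2 + 31 * n + 18)
      - (84 * n ^ 2 + 45 * n + 45) / 2 + (17 * n ^ 2 - 9 * n - 73) / 3) / (250 * n ^ 2) := by
    unfold ratioBound
    rw [intervalIntegral.integral_div, intervalIntegral.integral_add, intervalIntegral.integral_sub]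
    · rw [intervalIntegral.integral_const_mul, intervalIntegral.integral_const_mul, integral_pow,
        integral_id, intervalIntegral.integral_const]
      norm_num
      ring
    all_goals exact Continuous.intervalIntegrable (by fun_prop) _ _
  rw [hI, div_lt_iff₀ (by positivity)]
  norm_num
  -- The difference of the two sides is `n ^ 2 / 3 - 11 * n / 2 + 173 / 6`, of negative discriminant
  -- and minimal at `n = 33 / 4`.
  nlinarith [sq_nonneg (n - 33 / 4)]

/-! ### The law of the total reward -/

section Rewarded

variable {X Y : Type*} {r : X → Y → ℝ}

theorem reward_eq_indicator (hr01 : ∀ x y, r x y = 0 ∨ r x y = 1) (x : X) :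
    r x = {y | r x y = 1}.indicator 1 := by
  ext y
  rcases hr01 x y with h | h <;> simp [Set.indicator, h]

open Classical in
/-- The set of indices of the rewarded responses in a group. -/
noncomputable def rewarded (r : X → Y → ℝ) {G : ℕ} (x : X) (y : Fin G → Y) : Finset (Fin G) :=
  {j | r x (y j) = 1}

theorem mem_rewarded {G : ℕ} {x : X} {y : Fin G → Y} {j : Fin G} :
    j ∈ rewarded r x y ↔ r x (y j) = 1 := by
  simp [rewarded]

theorem totalReward_eq_card (hr01 : ∀ x y, r x y = 0 ∨ r x y = 1) {G : ℕ} (x : X)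
    (y : Fin G → Y) : totalReward r x y = (rewarded r x y).card := by
  classical
  unfold totalReward rewarded
  rw [Finset.card_filter, Nat.cast_sum]
  refine Finset.sum_congr rfl fun j _ => ?_
  rcases hr01 x (y j) with h | h <;> simp [h]

open Classical in
theorem setOf_rewarded_eq {G : ℕ} (x : X) (s : Finset (Fin G)) :
    {y : Fin G → Y | rewarded r x y = s} =
      Set.univ.pi fun j => if j ∈ s then {z | r x z = 1} else {z | r x z = 1}ᶜ := by
  ext y
  simp only [Set.mem_ofPred_eq, Finset.ext_iff, mem_rewarded, Set.mem_pi, Set.mem_univ, true_imp_iff]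
  refine forall_congr' fun j => ?_
  by_cases h : j ∈ s <;> simp [h]

theorem nonDegenerate_eq (hr01 : ∀ x y, r x y = 0 ∨ r x y = 1) {G : ℕ} (x : X) :
    nonDegenerate r G x =
      ({y | (rewarded r x y).card = 0} ∪ {y | (rewarded r x y).card = G})ᶜ := by
  ext y
  have hle : (rewarded r x y).card ≤ G := (Finset.card_le_univ _).trans_eq (Fintype.card_fin G)
  simp only [nonDegenerate, totalReward_eq_card hr01, Set.mem_ofPred_eq, Set.mem_compl_iff,
    Set.mem_union, le_sub_iff_add_le]
  norm_cast
  omega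

theorem totalReward_one_sub (r : X → Y → ℝ) {G : ℕ} (x : X) (y : Fin G → Y) :
    totalReward (fun x y => 1 - r x y) x y = G - totalReward r x y := by
  simp [totalReward]

theorem nonDegenerate_one_sub (r : X → Y → ℝ) (G : ℕ) (x : X) :
    nonDegenerate (fun x y => 1 - r x y) G x = nonDegenerate r G x := by
  ext y
  simp only [nonDegenerate, totalReward_one_sub, Set.mem_ofPred_eq]
  constructor <;> rintro ⟨h1, h2⟩ <;> constructor <;> linarith

end Rewarded

section Fiber

variable {X Y : Type*} [MeasurableSpace X] [MeasurableSpace Y] {π : Kernel X Y} {r : X → Y → ℝ}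

theorem measurableSet_reward_eq_one (hr : Measurable (Function.uncurry r)) (x : X) :
    MeasurableSet {y | r x y = 1} :=
  (hr.comp measurable_prodMk_left) (measurableSet_singleton 1)

theorem expectedReward_eq_measureReal (hr : Measurable (Function.uncurry r))
    (hr01 : ∀ x y, r x y = 0 ∨ r x y = 1) (x : X) :
    expectedReward π r x = (π x).real {y | r x y = 1} := by
  unfold expectedReward
  rw [reward_eq_indicator hr01 x, integral_indicator_one (measurableSet_reward_eq_one hr x),
    ← reward_eq_indicator hr01 x]

theorem measurableSet_rewarded_eq (hr : Measurable (Function.uncurry r)) {G : ℕ} (x : X)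
    (s : Finset (Fin G)) : MeasurableSet {y : Fin G → Y | rewarded r x y = s} := by
  classical
  rw [setOf_rewarded_eq]
  refine MeasurableSet.univ_pi fun j => ?_
  have := measurableSet_reward_eq_one hr x
  split_ifs
  exacts [this, this.compl]

theorem measurableSet_card_rewarded_eq (hr : Measurable (Function.uncurry r)) {G : ℕ} (x : X)
    (k : ℕ) : MeasurableSet {y : Fin G → Y | (rewarded r x y).card = k} := by
  have : {y : Fin G → Y | (rewarded r x y).card = k} =
      ⋃ s ∈ {s : Finset (Fin G) | s.card = k}, {y | rewarded r x y = s} := by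
    ext y; simp
  rw [this]
  exact MeasurableSet.biUnion (Set.to_countable _) fun s _ => measurableSet_rewarded_eq hr x s

variable [IsMarkovKernel π]

instance isProbabilityMeasure_groupLaw (G : ℕ) (x : X) : IsProbabilityMeasure (groupLaw π G x) := by
  unfold groupLaw; infer_instance

theorem groupLaw_real_rewarded_eq (hr : Measurable (Function.uncurry r))
    (hr01 : ∀ x y, r x y = 0 ∨ r x y = 1) {G : ℕ} (x : X) (s : Finset (Fin G)) :
    (groupLaw π G x).real {y | rewarded r x y = s} =
      expectedReward π r x ^ s.card * (1 - expectedReward π r x) ^ (G - s.card) := by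
  classical
  rw [setOf_rewarded_eq, measureReal_def, groupLaw, Measure.pi_pi, ENNReal.toReal_prod]
  have h (j : Fin G) : (π x (if j ∈ s then {z | r x z = 1} else {z | r x z = 1}ᶜ)).toReal =
      if j ∈ s then expectedReward π r x else 1 - expectedReward π r x := by
    rw [expectedReward_eq_measureReal hr hr01]
    split_ifs
    · rfl
    · exact probReal_compl_eq_one_sub (measurableSet_reward_eq_one hr x)
  simp_rw [h]
  rw [Finset.prod_ite, Finset.prod_const, Finset.prod_const]
  congr 2
  · simp
  · rw [Finset.filter_not, Finset.card_sdiff]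
    simp

/-- The number of rewarded responses is binomially distributed. -/
theorem groupLaw_real_card_rewarded_eq (hr : Measurable (Function.uncurry r))
    (hr01 : ∀ x y, r x y = 0 ∨ r x y = 1) {G : ℕ} (x : X) (k : ℕ) :
    (groupLaw π G x).real {y | (rewarded r x y).card = k} =
      G.choose k * (expectedReward π r x ^ k * (1 - expectedReward π r x) ^ (G - k)) := by
  have hU : {y : Fin G → Y | (rewarded r x y).card = k} =
      ⋃ s ∈ Finset.powersetCard k (Finset.univ : Finset (Fin G)), {y | rewarded r x y = s} := by
    ext y; simp
  rw [hU, measureReal_biUnion_finset]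
  · rw [Finset.sum_congr rfl fun s hs => by
      rw [groupLaw_real_rewarded_eq hr hr01 x s, (Finset.mem_powersetCard.1 hs).2]]
    simp
  · intro s _ t _ hst
    exact Set.disjoint_left.2 fun y hs ht => hst (hs.symm.trans ht)
  · exact fun s _ => measurableSet_rewarded_eq hr x s

theorem measurableSet_nonDegenerate (hr : Measurable (Function.uncurry r))
    (hr01 : ∀ x y, r x y = 0 ∨ r x y = 1) {G : ℕ} (x : X) :
    MeasurableSet (nonDegenerate r G x) := by
  rw [nonDegenerate_eq hr01]
  exact ((measurableSet_card_rewarded_eq hr x 0).union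
    (measurableSet_card_rewarded_eq hr x G)).compl

theorem groupLaw_real_nonDegenerate (hr : Measurable (Function.uncurry r))
    (hr01 : ∀ x y, r x y = 0 ∨ r x y = 1) {G : ℕ} (hG : G ≠ 0) (x : X) :
    (groupLaw π G x).real (nonDegenerate r G x) =
      1 - (1 - expectedReward π r x) ^ G - expectedReward π r x ^ G := by
  have h0 := measurableSet_card_rewarded_eq (G := G) hr x 0
  have hG' := measurableSet_card_rewarded_eq (G := G) hr x G
  rw [nonDegenerate_eq hr01, probReal_compl_eq_one_sub (h0.union hG'), measureReal_union _ hG',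
    groupLaw_real_card_rewarded_eq hr hr01, groupLaw_real_card_rewarded_eq hr hr01]
  · simp; ring
  · refine Set.disjoint_left.2 fun y (h0 : _ = 0) (hG' : _ = G) => hG (hG'.symm.trans h0)

/-! ### Underestimation at a fixed prompt -/

/-- The value of `ℙ(Â < A ∣ 𝒮)` at a prompt of expected reward `p`, for `0 < p < 2 / n` and groups
of `n` responses. -/
noncomputable def underestimateProb (n : ℕ) (p : ℝ) : ℝ :=
  if p < 1 / n then 1 else 1 - n * p * (1 - p) ^ (n - 1) / (1 - (1 - p) ^ n - p ^ n)

theorem nonDegenerate_prob_pos {n : ℕ} (hn : 2 ≤ n) {p : ℝ} (hp0 : 0 < p) (hp1 : p < 1) :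
    0 < 1 - (1 - p) ^ n - p ^ n := by
  have h1 := pow_lt_self_of_lt_one₀ hp0 hp1 hn
  have h2 := pow_lt_self_of_lt_one₀ (sub_pos.2 hp1) (by linarith) hn
  linarith

theorem probGivenS_groupAdvantage_lt (hr : Measurable (Function.uncurry r))
    (hr01 : ∀ x y, r x y = 0 ∨ r x y = 1) {G : ℕ} (hG : 2 ≤ G) (i : Fin G) {x : X}
    (hp0 : 0 < expectedReward π r x) (hp1 : expectedReward π r x < 1)
    (hp2 : expectedReward π r x < 2 / G) :
    probGivenS π r G (fun x y => groupAdvantage r i x y < trueAdvantage π r i x y) x =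
      underestimateProb G (expectedReward π r x) := by
  have hG0 : (0 : ℝ) < G := by positivity
  have hS := groupLaw_real_nonDegenerate (π := π) hr hr01 (G := G) (by omega) x
  have h1 := groupLaw_real_card_rewarded_eq (π := π) hr hr01 (G := G) x 1
  have hpos := nonDegenerate_prob_pos hG hp0 hp1
  have hmS := measurableSet_nonDegenerate (G := G) hr hr01 x
  -- The advantage is underestimated exactly when the number of rewards exceeds its mean.
  have hE : {y : Fin G → Y | groupAdvantage r i x y < trueAdvantage π r i x y} =
      {y | expectedReward π r x * G < (rewarded r x y).card} := by
    ext y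
    simp only [groupAdvantage, trueAdvantage, groupBaseline, totalReward_eq_card hr01,
      Set.mem_ofPred_eq, sub_lt_sub_iff_left, lt_div_iff₀ hG0]
  unfold probGivenS underestimateProb
  rw [measureReal_def, cond_apply hmS, ENNReal.toReal_mul, ENNReal.toReal_inv, ← measureReal_def,
    ← measureReal_def, hE, hS]
  rw [lt_div_iff₀ hG0] at hp2
  simp only [lt_div_iff₀ hG0]
  split_ifs with hlt
  · have hsub : nonDegenerate r G x ∩ {y | expectedReward π r x * G < (rewarded r x y).card} =
        nonDegenerate r G x := by
      refine Set.inter_eq_left.2 fun y hy => hlt.trans_le ?_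
      rw [← totalReward_eq_card hr01]
      exact hy.1
    rw [hsub, hS, inv_mul_cancel₀ hpos.ne']
  · have hsub : nonDegenerate r G x ∩ {y | expectedReward π r x * G < (rewarded r x y).card} =
        nonDegenerate r G x \ {y | (rewarded r x y).card = 1} := by
      ext y
      simp only [Set.mem_inter_iff, Set.mem_sdiff, Set.mem_ofPred_eq]
      refine and_congr_right fun hy => ?_
      have hy1 := hy.1
      rw [totalReward_eq_card hr01] at hy1
      push Not at hlt
      constructor
      · intro h h'
        rw [h'] at h
        push_cast at h
        linarith
      · intro h
        have : 1 ≤ (rewarded r x y).card := by exact_mod_cast hy1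
        have h2 : (2 : ℝ) ≤ (rewarded r x y).card := by
          exact_mod_cast (show 2 ≤ (rewarded r x y).card by omega)
        linarith
    have hle : {y : Fin G → Y | (rewarded r x y).card = 1} ⊆ nonDegenerate r G x := by
      intro y (hy : _ = 1)
      rw [nonDegenerate_eq hr01]
      simp only [Set.mem_compl_iff, Set.mem_union, Set.mem_ofPred_eq, hy]
      omega
    rw [hsub, measureReal_sdiff hle (measurableSet_card_rewarded_eq hr x 1), hS, h1]
    field_simp
    simp
    ring

end Fiber

/-! ### Averaging over prompts -/

theorem measurable_underestimateProb (n : ℕ) : Measurable (underestimateProb n) := by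
  unfold underestimateProb
  exact Measurable.ite measurableSet_Iio measurable_const (by fun_prop)

theorem lt_integral_underestimateProb {n : ℕ} (hn : 6 ≤ n) :
    0.78 * (2 / n) < ∫ p in (0 : ℝ)..(2 / n), underestimateProb n p := by
  have hn6 : (6 : ℝ) ≤ n := by exact_mod_cast hn
  have hn0 : (0 : ℝ) < n := by linarith
  have h01 : (0 : ℝ) ≤ 1 / n := by positivity
  have h12 : (1 : ℝ) / n ≤ 2 / n := by gcongr; norm_num
  have h2 : (2 : ℝ) / n < 1 := by rw [div_lt_one hn0]; linarith
  have hden : ∀ p ∈ Set.Icc (1 / (n : ℝ)) (2 / n), 0 < 1 - (1 - p) ^ n - p ^ n := fun p hp =>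
    nonDegenerate_prob_pos (by omega) (lt_of_lt_of_le (by positivity) hp.1) (hp.2.trans_lt h2)
  have hlow : Set.EqOn (underestimateProb n) (fun _ => 1) (Set.Ioo 0 (1 / (n : ℝ))) := fun p hp =>
    if_pos hp.2
  have hhigh : Set.EqOn (underestimateProb n)
      (fun p => 1 - n * p * (1 - p) ^ (n - 1) / (1 - (1 - p) ^ n - p ^ n))
      (Set.Icc (1 / (n : ℝ)) (2 / n)) := fun p hp => if_neg hp.1.not_gt
  have hcont : ContinuousOn (underestimateProb n) (Set.Icc (1 / (n : ℝ)) (2 / n)) := by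
    refine ContinuousOn.congr ?_ hhigh
    refine continuousOn_const.sub (ContinuousOn.div (by fun_prop) (by fun_prop) ?_)
    exact fun p hp => (hden p hp).ne'
  have hint1 : IntervalIntegrable (underestimateProb n) volume 0 (1 / n) :=
    (intervalIntegrable_const (c := (1 : ℝ))).congr_uIoo (by
      rw [Set.uIoo_of_le h01]; exact hlow.symm)
  have hint2 : IntervalIntegrable (underestimateProb n) volume (1 / n) (2 / n) :=
    hcont.intervalIntegrable_of_Icc h12
  have hA : Continuous fun p : ℝ => 1 - ratioBound n (n * p - 1) := by
    unfold ratioBound; fun_prop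
  have hmono : ∫ p in (1 / n : ℝ)..(2 / n), (1 - ratioBound n (n * p - 1)) ≤
      ∫ p in (1 / n : ℝ)..(2 / n), underestimateProb n p := by
    refine intervalIntegral.integral_mono_on h12 (hA.intervalIntegrable _ _) hint2 fun p hp => ?_
    rw [hhigh hp]
    refine sub_le_sub_left ?_ _
    rw [div_le_iff₀ (hden p hp)]
    exact one_success_le_ratioBound_mul hn hp.1 hp.2
  have hsub : ∫ p in (1 / n : ℝ)..(2 / n), (1 - ratioBound n (n * p - 1)) =
      (n : ℝ)⁻¹ * (1 - ∫ s in (0 : ℝ)..1, ratioBound n s) := by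
    rw [intervalIntegral.integral_comp_mul_sub (fun s => 1 - ratioBound n s) hn0.ne' 1,
      mul_one_div_cancel hn0.ne', mul_div_cancel₀ _ hn0.ne', intervalIntegral.integral_sub
        intervalIntegrable_const (Continuous.intervalIntegrable (by unfold ratioBound; fun_prop) _ _)]
    norm_num
  have hone : ∫ p in (0 : ℝ)..(1 / n), underestimateProb n p = (n : ℝ)⁻¹ := by
    rw [intervalIntegral.integral_congr_Ioo_of_le h01 hlow]
    simp
  rw [← intervalIntegral.integral_add_adjacent_intervals hint1 hint2, hone]
  rw [hsub] at hmono
  have hlt := integral_ratioBound_lt hn6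
  have hinv : 0 < (n : ℝ)⁻¹ := inv_pos.2 hn0
  calc 0.78 * (2 / (n : ℝ)) = (n : ℝ)⁻¹ + (n : ℝ)⁻¹ * (1 - 0.44) := by ring
    _ < (n : ℝ)⁻¹ + (n : ℝ)⁻¹ * (1 - ∫ s in (0 : ℝ)..1, ratioBound n s) := by gcongr
    _ ≤ _ := by gcongr

variable {X Y : Type*} [MeasurableSpace X] [MeasurableSpace Y]

theorem lt_meanProbGivenS_groupAdvantage_lt (D : Measure X)
    (π : Kernel X Y) [IsMarkovKernel π]
    (r : X → Y → ℝ) (hr : Measurable (Function.uncurry r))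
    (hr01 : ∀ x y, r x y = 0 ∨ r x y = 1)
    (hp : pdf.IsUniform (expectedReward π r) (Set.Icc (0 : ℝ) 1) D volume)
    {G : ℕ} (hG : 6 ≤ G) (i : Fin G) :
    0.78 < meanProbGivenS D π r G
      (fun x y => groupAdvantage r i x y < trueAdvantage π r i x y) {p | p < 2 / (G : ℝ)} := by
  have hG6 : (6 : ℝ) ≤ G := by exact_mod_cast hG
  have hG0 : (0 : ℝ) < G := by linarith
  have h0 : (0 : ℝ) < 2 / G := by positivity
  have h1 : (2 : ℝ) / G < 1 := by rw [div_lt_one hG0]; linarith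
  have hpm : AEMeasurable (expectedReward π r) D := hp.aemeasurable (by simp) (by simp)
  have hmap : D.map (expectedReward π r) = volume.restrict (Set.Icc 0 1) := by
    have : D.map (expectedReward π r) = volume[|Set.Icc (0 : ℝ) 1] := hp
    simp [this, ProbabilityTheory.cond]
  have hset : {p : ℝ | p < 2 / (G : ℝ)} = Set.Iio (2 / (G : ℝ)) := rfl
  have hinter : Set.Iio (2 / (G : ℝ)) ∩ Set.Icc 0 1 = Set.Ico 0 (2 / (G : ℝ)) := by
    ext p; simp; grind
  have hmeas : D.real {x | expectedReward π r x ∈ Set.Iio (2 / (G : ℝ))} = 2 / G := by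
    have := map_measureReal_apply_of_aemeasurable hpm (measurableSet_Iio (a := 2 / (G : ℝ)))
    rw [hmap, measureReal_restrict_apply measurableSet_Iio] at this
    rw [show {x | expectedReward π r x ∈ Set.Iio (2 / (G : ℝ))} =
      expectedReward π r ⁻¹' Set.Iio (2 / (G : ℝ)) from rfl, ← this, hinter]
    simp [h0.le]
  have hpos : ∀ᵐ x ∂D, 0 < expectedReward π r x := by
    refine ae_of_ae_map (p := fun p : ℝ => 0 < p) hpm ?_
    rw [hmap, ← restrict_Ioc_eq_restrict_Icc]
    filter_upwards [ae_restrict_mem measurableSet_Ioc] with p hp using hp.1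
  have hnull : NullMeasurableSet {x | expectedReward π r x ∈ Set.Iio (2 / (G : ℝ))} D :=
    hpm.nullMeasurableSet_preimage measurableSet_Iio
  have hcongr : ∫ x in {x | expectedReward π r x ∈ Set.Iio (2 / (G : ℝ))}, probGivenS π r G
        (fun x y => groupAdvantage r i x y < trueAdvantage π r i x y) x ∂D =
      ∫ x in expectedReward π r ⁻¹' Set.Iio (2 / (G : ℝ)),
        underestimateProb G (expectedReward π r x) ∂D := by
    refine integral_congr_ae ?_
    filter_upwards [ae_restrict_of_ae hpos, ae_restrict_mem₀ hnull] with x hx0 hx2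
    exact probGivenS_groupAdvantage_lt hr hr01 (by omega) i hx0 (lt_trans hx2 h1) hx2
  unfold meanProbGivenS
  rw [hset, setAverage_eq, hmeas, hcongr, ← setIntegral_map measurableSet_Iio
    (measurable_underestimateProb G).aestronglyMeasurable hpm, hmap,
    Measure.restrict_restrict measurableSet_Iio, smul_eq_mul, hinter,
    integral_Ico_eq_integral_Ioo, ← integral_Ioc_eq_integral_Ioo,
    ← intervalIntegral.integral_of_le h0.le, inv_mul_eq_div, lt_div_iff₀ h0]
  exact lt_integral_underestimateProb hG

/-! ### Exchanging successes and failures -/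

theorem isUniform_one_sub {Ω : Type*} [MeasurableSpace Ω] {ν : Measure Ω} {f : Ω → ℝ}
    (hf : pdf.IsUniform f (Set.Icc (0 : ℝ) 1) ν volume) :
    pdf.IsUniform (fun ω => 1 - f ω) (Set.Icc (0 : ℝ) 1) ν volume := by
  have hfm : AEMeasurable f ν := hf.aemeasurable (by simp) (by simp)
  have hmap : ν.map f = volume.restrict (Set.Icc 0 1) := by
    have : ν.map f = volume[|Set.Icc (0 : ℝ) 1] := hf
    simp [this, ProbabilityTheory.cond]
  have hpres := (Measure.measurePreserving_sub_left (volume : Measure ℝ) 1).restrict_preimage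
    (measurableSet_Icc (a := (0 : ℝ)) (b := 1))
  have hcomp := AEMeasurable.map_map_of_aemeasurable (μ := ν) (f := f) (g := fun p : ℝ => 1 - p)
    (by fun_prop) hfm
  have himg : (fun p : ℝ => 1 - p) ⁻¹' Set.Icc (0 : ℝ) 1 = Set.Icc 0 1 := by
    simp
  rw [himg] at hpres
  change ν.map ((fun p : ℝ => 1 - p) ∘ f) = _
  rw [← hcomp, hmap, hpres.map_eq, ProbabilityTheory.cond]
  simp

theorem expectedReward_one_sub {π : Kernel X Y} [IsMarkovKernel π] {r : X → Y → ℝ}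
    (hr : Measurable (Function.uncurry r)) (hr01 : ∀ x y, r x y = 0 ∨ r x y = 1) (x : X) :
    expectedReward π (fun x y => 1 - r x y) x = 1 - expectedReward π r x := by
  have hint : Integrable (r x) (π x) := by
    rw [reward_eq_indicator hr01 x]
    exact (integrable_const 1).indicator (measurableSet_reward_eq_one hr x)
  simp [expectedReward, integral_sub (integrable_const 1) hint]

theorem meanProbGivenS_one_sub (D : Measure X) {π : Kernel X Y} [IsMarkovKernel π]
    {r : X → Y → ℝ} (hr : Measurable (Function.uncurry r)) (hr01 : ∀ x y, r x y = 0 ∨ r x y = 1)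
    {G : ℕ} (hG : G ≠ 0) (i : Fin G) :
    meanProbGivenS D π (fun x y => 1 - r x y) G
        (fun x y => groupAdvantage (fun x y => 1 - r x y) i x y <
          trueAdvantage π (fun x y => 1 - r x y) i x y) {p | p < 2 / (G : ℝ)} =
      meanProbGivenS D π r G
        (fun x y => groupAdvantage r i x y > trueAdvantage π r i x y)
        {p | p > ((G : ℝ) - 2) / G} := by
  have hG0 : (G : ℝ) ≠ 0 := by exact_mod_cast hG
  unfold meanProbGivenS probGivenS
  have hset : {x | expectedReward π (fun x y => 1 - r x y) x ∈ {p : ℝ | p < 2 / (G : ℝ)}} =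
      {x | expectedReward π r x ∈ {p : ℝ | p > ((G : ℝ) - 2) / G}} := by
    ext x
    simp only [Set.mem_ofPred_eq, expectedReward_one_sub hr hr01, sub_div, div_self hG0]
    constructor <;> intro h <;> linarith
  have hE (x : X) : {y : Fin G → Y | groupAdvantage (fun x y => 1 - r x y) i x y <
      trueAdvantage π (fun x y => 1 - r x y) i x y} =
      {y | groupAdvantage r i x y > trueAdvantage π r i x y} := by
    ext y
    simp only [groupAdvantage, trueAdvantage, groupBaseline, totalReward_one_sub,
      expectedReward_one_sub hr hr01, Set.mem_ofPred_eq, sub_div, div_self hG0]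
    constructor <;> intro h <;> linarith
  rw [hset]
  simp only [nonDegenerate_one_sub, hE]

end GroupRL

theorem mainTheorem5 {X Y : Type*} [MeasurableSpace X] [MeasurableSpace Y]
    (D : Measure X) [IsProbabilityMeasure D]
    (π : Kernel X Y) [IsMarkovKernel π]
    (r : X → Y → ℝ) (hr : Measurable (Function.uncurry r))
    (hr01 : ∀ x y, r x y = 0 ∨ r x y = 1)
    (hp : pdf.IsUniform (GroupRL.expectedReward π r) (Set.Icc (0 : ℝ) 1) D volume)
    (G : ℕ) (hG : 6 ≤ G) (i : Fin G) :
    0.78 < GroupRL.meanProbGivenS D π r G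
        (fun x y => GroupRL.groupAdvantage r i x y < GroupRL.trueAdvantage π r i x y)
        {p | p < 2 / (G : ℝ)} ∧
    0.78 < GroupRL.meanProbGivenS D π r G
        (fun x y => GroupRL.groupAdvantage r i x y > GroupRL.trueAdvantage π r i x y)
        {p | p > ((G : ℝ) - 2) / G} := by
  refine ⟨GroupRL.lt_meanProbGivenS_groupAdvantage_lt D π r hr hr01 hp hG i, ?_⟩
  -- Exchanging the rewards `0` and `1` turns the second claim into the first.
  rw [← GroupRL.meanProbGivenS_one_sub D hr hr01 (by omega) i]
  refine GroupRL.lt_meanProbGivenS_groupAdvantage_lt D π (fun x y => 1 - r x y)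
    (measurable_const.sub hr : Measurable fun z => 1 - Function.uncurry r z) ?_ ?_ hG i
  · intro x y
    rcases hr01 x y with h | h <;> simp [h]
  · rw [show GroupRL.expectedReward π (fun x y => 1 - r x y) =
      fun x => 1 - GroupRL.expectedReward π r x from
        funext (GroupRL.expectedReward_one_sub hr hr01)]
    exact GroupRL.isUniform_one_sub hp
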